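/- Let $G$ be the group of all bijections $g:\mathbb Z\to\mathbb Z$ that move only finitely many integers and satisfy $g(0)=0$ and $g(\mathbb N)=\mathbb N$, where $\mathbb N=\{1,2,3,\dots\}$, and let $K=\{g\in G: g(-i)=-g(i)\text{ for all }i\in\mathbb Z\}$. Let $\pi$ be a spherical representation of the pair $(G,K)$, that is, an irreducible unitary representation of $G$ in a complex Hilbert space $H$ that has a nonzero $K$-fixed vector, and let $\xi\in H$ be a $K$-fixed unit vector. Let $A_1$ be the bounded self-adjoint operator on $H$ that is the limit of the operators $\pi((1\,n))$, $n\to+\infty$, in the weak operator topology (this limit exists), where $(1\,n)\in G$ is the transposition of $1$ and $n$. Let $\mu$ be the spectral measure of $A_1$ and $\xi$, that is, the finite Borel measure on $\mathbb R$ carried by the spectrum of $A_1$ with $(f(A_1)\xi,\xi)=\int f\,d\mu$ for every continuous function $f:\mathbb R\to\mathbb R$. Then for every real $x\neq 0$ with $\mu(\{x\})\neq 0$ the number $\nu(x)=\mu(\{x\})/|x|$ is a positive integer. -/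

import Mathlib

open Filter Topology MeasureTheory

namespace Olshanski

/-! ### The Olshanski pair -/

/-- The group of bijections of `ℤ` that move only finitely many integers, fix `0` and map the set
of positive integers onto itself. -/
def GD : Subgroup (Equiv.Perm ℤ) where
  carrier := {g | {i | g i ≠ i}.Finite ∧ g 0 = 0 ∧ ∀ i, 0 < g i ↔ 0 < i}
  one_mem' := by simp
  mul_mem' := by
    rintro a b ⟨ha, ha0, hap⟩ ⟨hb, hb0, hbp⟩
    refine ⟨(ha.union hb).subset ?_, by simp [hb0, ha0], fun i => by simp [hap, hbp]⟩
    intro i hi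
    by_contra h
    simp only [Set.mem_union, Set.mem_ofPred_eq, not_or, not_not] at h
    exact hi (by simp [h.2, h.1])
  inv_mem' := by
    rintro a ⟨ha, ha0, hap⟩
    refine ⟨ha.subset ?_, by rw [Equiv.Perm.inv_eq_iff_eq, ha0], fun i => ?_⟩
    · intro i hi h
      exact hi (by rw [Equiv.Perm.inv_eq_iff_eq]; exact h.symm)
    · rw [← hap (a⁻¹ i)]; simp

/-- The subgroup of elements of `GD` that commute with `i ↦ -i`. -/
def KD : Subgroup GD where
  carrier := {g | ∀ i : ℤ, g.1 (-i) = -g.1 i}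
  one_mem' := by simp
  mul_mem' := by
    intro a b ha hb i
    simp only [Set.mem_ofPred_eq] at ha hb
    simp [ha, hb]
  inv_mem' := by
    intro a ha i
    simp only [Set.mem_ofPred_eq] at ha
    change a.1⁻¹ (-i) = -a.1⁻¹ i
    rw [Equiv.Perm.inv_eq_iff_eq, ha]; simp

theorem swap_mem_GD {a b : ℤ} (ha : 0 < a) (hb : 0 < b) : Equiv.swap a b ∈ GD := by
  refine ⟨(Set.toFinite {a, b}).subset ?_, Equiv.swap_apply_of_ne_of_ne ha.ne hb.ne, fun i => ?_⟩
  · intro i hi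
    by_contra h
    simp only [Set.mem_insert_iff, Set.mem_singleton_iff, not_or] at h
    exact hi (Equiv.swap_apply_of_ne_of_ne h.1 h.2)
  · rw [Equiv.swap_apply_def]
    split_ifs <;> omega

/-- The transposition `(1, n + 1)`, as an element of `GD`. -/
def transp (n : ℕ) : GD :=
  ⟨Equiv.swap 1 ((n : ℤ) + 1), swap_mem_GD (by norm_num) (by positivity)⟩

/-! ### Spherical representations -/

section

variable {H : Type*} [NormedAddCommGroup H] [InnerProductSpace ℂ H] [CompleteSpace H]

/-- A unitary representation is irreducible if the space is nonzero and the only closed invariant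
subspaces are the two trivial ones. -/
def IsIrreducibleRep (π : GD →* unitary (H →L[ℂ] H)) : Prop :=
  Nontrivial H ∧ ∀ W : Submodule ℂ H, IsClosed (W : Set H) →
    (∀ g : GD, ∀ v ∈ W, (π g : H →L[ℂ] H) v ∈ W) → W = ⊥ ∨ W = ⊤

/-- The vector `v` is fixed by the subgroup `KD`. -/
def IsKFixed (π : GD →* unitary (H →L[ℂ] H)) (v : H) : Prop :=
  ∀ k ∈ KD, (π k : H →L[ℂ] H) v = v

/-- A spherical representation of the pair `(GD, KD)`: an irreducible unitary representation of
`GD` with a nonzero `KD`-fixed vector. -/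
def IsSpherical (π : GD →* unitary (H →L[ℂ] H)) : Prop :=
  IsIrreducibleRep π ∧ ∃ v : H, v ≠ 0 ∧ IsKFixed π v

/-- A spherical vector: a `KD`-fixed unit vector. -/
def IsSphericalVector (π : GD →* unitary (H →L[ℂ] H)) (ξ : H) : Prop :=
  ‖ξ‖ = 1 ∧ IsKFixed π ξ

/-- `A` is the limit of `π((1, n))` in the weak operator topology, as `n → ∞`. -/
def IsWeakLimit (π : GD →* unitary (H →L[ℂ] H)) (A : H →L[ℂ] H) : Prop :=
  ∀ v w : H, Tendsto (fun n => inner ℂ ((π (transp n) : H →L[ℂ] H) v) w) atTop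
    (𝓝 (inner ℂ (A v) w))

/-- `v` is fixed by the elements of `KD` that fix all `i` with `|i| ≤ m`. -/
def IsFixedAt (π : GD →* unitary (H →L[ℂ] H)) (m : ℕ) (v : H) : Prop :=
  ∀ k ∈ KD, (∀ i : ℤ, |i| ≤ m → k.1 i = i) → (π k : H →L[ℂ] H) v = v

theorem IsFixedAt.mono {π : GD →* unitary (H →L[ℂ] H)} {m n : ℕ} {v : H}
    (h : IsFixedAt π m v) (hmn : m ≤ n) : IsFixedAt π n v := fun k hk hi =>
  h k hk fun i him => hi i (him.trans (by exact_mod_cast hmn))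

theorem norm_rep (π : GD →* unitary (H →L[ℂ] H)) (g : GD) (v : H) :
    ‖(π g : H →L[ℂ] H) v‖ = ‖v‖ := by
  have h := (Unitary.mem_iff.1 (π g).2).1
  exact (ContinuousLinearMap.norm_map_iff_adjoint_comp_self _).2 h v

theorem inner_rep (π : GD →* unitary (H →L[ℂ] H)) (g : GD) (v w : H) :
    inner ℂ ((π g : H →L[ℂ] H) v) ((π g : H →L[ℂ] H) w) = inner ℂ v w := by
  have h := (Unitary.mem_iff.1 (π g).2).1
  exact (ContinuousLinearMap.inner_map_map_iff_adjoint_comp_self _).2 h v w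

/-- The vectors that satisfy `IsFixedAt π m` for some `m` form a dense subspace of a spherical representation. -/
theorem exists_isFixedAt_near {π : GD →* unitary (H →L[ℂ] H)} (hπ : IsSpherical π) (v : H)
    {ε : ℝ} (hε : 0 < ε) : ∃ u m, IsFixedAt π m u ∧ ‖v - u‖ < ε := by
  obtain ⟨⟨-, hirr⟩, v₀, hv₀, hfix⟩ := hπ
  let D : Submodule ℂ H :=
    { carrier := {u | ∃ m, IsFixedAt π m u}
      zero_mem' := ⟨0, fun k _ _ => by simp⟩
      add_mem' := by
        rintro a b ⟨m, hm⟩ ⟨n, hn⟩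
        refine ⟨max m n, fun k hk hi => ?_⟩
        rw [map_add, hm.mono (le_max_left m n) k hk hi, hn.mono (le_max_right m n) k hk hi]
      smul_mem' := by
        rintro c a ⟨m, hm⟩
        exact ⟨m, fun k hk hi => by rw [map_smul, hm k hk hi]⟩ }
  have hinv : ∀ g : GD, ∀ u ∈ D, (π g : H →L[ℂ] H) u ∈ D := by
    rintro g u ⟨m, hm⟩
    obtain ⟨N, hN⟩ := (g.2.1.image fun i : ℤ => i.natAbs).bddAbove
    refine ⟨max m N, fun k hk hi => ?_⟩
    have hcomm : k * g = g * k := by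
      apply Subtype.ext
      apply Equiv.Perm.Disjoint.commute
      intro i
      by_cases h : g.1 i = i
      · exact Or.inr h
      · left
        have := hN (Set.mem_image_of_mem _ h)
        apply hi
        have h2 : i.natAbs ≤ max m N := le_trans this (le_max_right _ _)
        rw [Int.abs_eq_natAbs]
        exact_mod_cast h2
    have h1 : (π k : H →L[ℂ] H) ((π g : H →L[ℂ] H) u)
        = (π g : H →L[ℂ] H) ((π k : H →L[ℂ] H) u) := by
      have := congrArg (fun x : GD => (π x : H →L[ℂ] H) u) hcomm
      simpa using this
    rw [h1, hm.mono (le_max_left m N) k hk hi]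
  have htop : D.topologicalClosure = ⊤ := by
    refine (hirr _ D.isClosed_topologicalClosure fun g u hu => ?_).resolve_left fun h => ?_
    · exact map_mem_closure (π g : H →L[ℂ] H).continuous hu fun x hx => hinv g x hx
    · have : v₀ ∈ D.topologicalClosure :=
        D.le_topologicalClosure ⟨0, fun k hk _ => hfix k hk⟩
      rw [h] at this
      exact hv₀ (by simpa using this)
  have hv : v ∈ closure (D : Set H) := by
    have : v ∈ D.topologicalClosure := by rw [htop]; trivial
    exact this
  obtain ⟨u, ⟨m, hm⟩, hu⟩ := Metric.mem_closure_iff.1 hv ε hε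
  exact ⟨u, m, hm, by rwa [← dist_eq_norm]⟩

/-- On vectors with `IsFixedAt π m`, the matrix elements of `transp n` do not depend on `n > m`. -/
theorem inner_transp_eq {π : GD →* unitary (H →L[ℂ] H)} {m : ℕ} {v w : H} (hv : IsFixedAt π m v)
    (hw : IsFixedAt π m w) {a b : ℕ} (ha : m < a) (hb : m < b) :
    inner ℂ ((π (transp a) : H →L[ℂ] H) v) w = inner ℂ ((π (transp b) : H →L[ℂ] H) v) w := by
  set x : ℤ := (a : ℤ) + 1 with hx
  set y : ℤ := (b : ℤ) + 1 with hy
  have hs : ∀ i : ℤ, (Equiv.swap x y * Equiv.swap (-x) (-y)) i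
      = if i = x then y else if i = y then x else if i = -x then -y else if i = -y then -x
        else i := by
    intro i
    simp only [Equiv.Perm.mul_apply, Equiv.swap_apply_def]
    split_ifs <;> omega
  have hcG : Equiv.swap x y * Equiv.swap (-x) (-y) ∈ GD := by
    refine ⟨(Set.toFinite {x, y, -x, -y}).subset ?_, ?_, fun i => ?_⟩
    · intro i hi
      by_contra h
      simp only [Set.mem_insert_iff, Set.mem_singleton_iff, not_or] at h
      exact hi (by rw [hs]; simp [h])
    · rw [hs]; split_ifs <;> omega
    · rw [hs]; split_ifs <;> omega
  let c : GD := ⟨_, hcG⟩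
  have hcK : c ∈ KD := by
    intro i
    change (Equiv.swap x y * Equiv.swap (-x) (-y)) (-i)
      = -(Equiv.swap x y * Equiv.swap (-x) (-y)) i
    rw [hs, hs]; split_ifs <;> omega
  have hcm : ∀ i : ℤ, |i| ≤ m → c.1 i = i := by
    intro i hi
    change (Equiv.swap x y * Equiv.swap (-x) (-y)) i = i
    rw [abs_le] at hi
    rw [hs]; split_ifs <;> omega
  have hconj : c * transp a = transp b * c := by
    apply Subtype.ext
    ext i
    change (Equiv.swap x y * Equiv.swap (-x) (-y)) (Equiv.swap 1 x i)
      = Equiv.swap 1 y ((Equiv.swap x y * Equiv.swap (-x) (-y)) i)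
    rw [hs, hs]
    simp only [Equiv.swap_apply_def]
    split_ifs <;> omega
  have h1 : (π c : H →L[ℂ] H) ((π (transp a) : H →L[ℂ] H) v)
      = (π (transp b) : H →L[ℂ] H) ((π c : H →L[ℂ] H) v) := by
    have := congrArg (fun z : GD => (π z : H →L[ℂ] H) v) hconj
    simpa using this
  rw [← inner_rep π c, h1, hv c hcK hcm, hw c hcK hcm]

theorem exists_lim_inner {π : GD →* unitary (H →L[ℂ] H)} (hπ : IsSpherical π) (v w : H) :
    ∃ z : ℂ, Tendsto (fun n => inner ℂ ((π (transp n) : H →L[ℂ] H) v) w) atTop (𝓝 z) := by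
  apply cauchySeq_tendsto_of_complete
  rw [Metric.cauchySeq_iff]
  intro ε hε
  set M : ℝ := ‖v‖ + ‖w‖ + 1 with hM
  have hMpos : 0 < M := by positivity
  set δ : ℝ := min 1 (ε / (4 * M)) with hδ
  have hδpos : 0 < δ := lt_min one_pos (by positivity)
  obtain ⟨v', m, hm, hv'⟩ := exists_isFixedAt_near hπ v hδpos
  obtain ⟨w', l, hl, hw'⟩ := exists_isFixedAt_near hπ w hδpos
  have hδM : δ * (4 * M) ≤ ε := by
    have := min_le_right 1 (ε / (4 * M))
    rw [← hδ, le_div_iff₀ (by positivity)] at this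
    exact this
  have hv1 : ‖v'‖ ≤ ‖v‖ + 1 := by
    have h1 := norm_sub_norm_le v' v
    rw [norm_sub_rev] at h1
    have := hv'.le.trans (min_le_left _ _)
    linarith
  have key : ∀ n, ‖(inner ℂ ((π (transp n) : H →L[ℂ] H) v) w : ℂ)
      - inner ℂ ((π (transp n) : H →L[ℂ] H) v') w'‖ < ε / 2 := by
    intro n
    have e : (inner ℂ ((π (transp n) : H →L[ℂ] H) v) w : ℂ)
        - inner ℂ ((π (transp n) : H →L[ℂ] H) v') w'
        = inner ℂ ((π (transp n) : H →L[ℂ] H) (v - v')) w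
          + inner ℂ ((π (transp n) : H →L[ℂ] H) v') (w - w') := by
      rw [map_sub, inner_sub_left, inner_sub_right]; ring
    rw [e]
    have h1 : ‖(inner ℂ ((π (transp n) : H →L[ℂ] H) (v - v')) w : ℂ)‖ ≤ δ * ‖w‖ := by
      refine (norm_inner_le_norm _ _).trans ?_
      rw [norm_rep]
      gcongr
    have h2 : ‖(inner ℂ ((π (transp n) : H →L[ℂ] H) v') (w - w') : ℂ)‖ ≤ (‖v‖ + 1) * δ := by
      refine (norm_inner_le_norm _ _).trans ?_
      rw [norm_rep]
      gcongr
    have h3 : δ * ‖w‖ + (‖v‖ + 1) * δ = δ * M := by rw [hM]; ring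
    have h4 : 0 < δ * M := by positivity
    refine (norm_add_le _ _).trans_lt ?_
    linarith
  refine ⟨max m l + 1, fun a ha b hb => ?_⟩
  rw [dist_eq_norm]
  have hab := inner_transp_eq (hm.mono (le_max_left m l)) (hl.mono (le_max_right m l))
    (a := a) (b := b) (by omega) (by omega)
  have ka := key a
  have kb := key b
  rw [hab] at ka
  rw [norm_sub_rev] at kb
  have := norm_add_le
    ((inner ℂ ((π (transp a) : H →L[ℂ] H) v) w : ℂ) - inner ℂ ((π (transp b) : H →L[ℂ] H) v') w')
    (inner ℂ ((π (transp b) : H →L[ℂ] H) v') w' - inner ℂ ((π (transp b) : H →L[ℂ] H) v) w)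
  rw [sub_add_sub_cancel] at this
  linarith

/-- In a spherical representation the weak limit of the transpositions `(1, n)` exists. -/
theorem exists_isWeakLimit {π : GD →* unitary (H →L[ℂ] H)} (hπ : IsSpherical π) :
    ∃ A : H →L[ℂ] H, IsWeakLimit π A := by
  choose B hB using exists_lim_inner hπ
  let B₁ : H →ₗ⋆[ℂ] H →ₗ[ℂ] ℂ := LinearMap.mk₂'ₛₗ (starRingEnd ℂ) (RingHom.id ℂ) B
    (fun v v' w => tendsto_nhds_unique (hB _ _)
      (by simpa only [map_add, inner_add_left] using (hB v w).add (hB v' w)))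
    (fun c v w => tendsto_nhds_unique (hB _ _)
      (by simpa only [map_smul, inner_smul_left, smul_eq_mul] using (hB v w).const_mul (starRingEnd ℂ c)))
    (fun v w w' => tendsto_nhds_unique (hB _ _)
      (by simpa only [inner_add_right] using (hB v w).add (hB v w')))
    (fun c v w => tendsto_nhds_unique (hB _ _)
      (by simpa only [inner_smul_right, smul_eq_mul, RingHom.id_apply] using (hB v w).const_mul c))
  have hbound : ∀ v w, ‖B₁ v w‖ ≤ 1 * ‖v‖ * ‖w‖ := by
    intro v w
    refine le_of_tendsto (hB v w).norm (Eventually.of_forall fun n => ?_)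
    refine (norm_inner_le_norm _ _).trans ?_
    rw [norm_rep, one_mul]
  let B₂ : H →L⋆[ℂ] H →L[ℂ] ℂ := B₁.mkContinuous₂ 1 hbound
  refine ⟨InnerProductSpace.continuousLinearMapOfBilin B₂, fun v w => ?_⟩
  rw [InnerProductSpace.continuousLinearMapOfBilin_apply]
  exact hB v w

theorem IsWeakLimit.unique {π : GD →* unitary (H →L[ℂ] H)} {A B : H →L[ℂ] H}
    (hA : IsWeakLimit π A) (hB : IsWeakLimit π B) : A = B :=
  ContinuousLinearMap.ext fun v => ext_inner_right ℂ fun w => tendsto_nhds_unique (hA v w) (hB v w)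

/-- The operator `A_1` of a spherical representation: the limit of `π((1, n))` in the weak operator
topology, as `n → ∞`. -/
noncomputable def opA₁ (π : GD →* unitary (H →L[ℂ] H)) (hπ : IsSpherical π) : H →L[ℂ] H :=
  Classical.choose (exists_isWeakLimit hπ)

theorem isWeakLimit_opA₁ (π : GD →* unitary (H →L[ℂ] H)) (hπ : IsSpherical π) :
    IsWeakLimit π (opA₁ π hπ) :=
  Classical.choose_spec (exists_isWeakLimit hπ)

theorem isSelfAdjoint_opA₁ (π : GD →* unitary (H →L[ℂ] H)) (hπ : IsSpherical π) :
    IsSelfAdjoint (opA₁ π hπ) := by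
  rw [ContinuousLinearMap.isSelfAdjoint_iff_isSymmetric]
  intro v w
  have h1 := isWeakLimit_opA₁ π hπ v w
  have h2 := (Complex.continuous_conj.tendsto _).comp (isWeakLimit_opA₁ π hπ w v)
  simp only [Function.comp_def, inner_conj_symm] at h2
  refine tendsto_nhds_unique h1 (h2.congr fun n => ?_)
  have hsq : transp n * transp n = 1 := Subtype.ext (Equiv.swap_mul_self _ _)
  rw [← inner_rep π (transp n)]
  congr 1
  have := congrArg (fun z : GD => (π z : H →L[ℂ] H) w) hsq
  simpa using this

/-! ### Spectral measures -/

/-- `μ` is the spectral measure of the bounded self-adjoint operator `A` and the vector `ξ`: a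
finite Borel measure carried by the spectrum of `A`, with `⟨ξ, f(A) ξ⟩ = ∫ f dμ` for all continuous
functions `f`. -/
def IsSpectralMeasure (A : H →L[ℂ] H) (ξ : H) (μ : Measure ℝ) : Prop :=
  IsFiniteMeasure μ ∧ μ (spectrum ℝ A)ᶜ = 0 ∧
    ∀ f : ℝ → ℝ, Continuous f → inner ℂ ξ (cfc f A ξ) = ((∫ t, f t ∂μ : ℝ) : ℂ)

theorem IsSpectralMeasure.unique {A : H →L[ℂ] H} {ξ : H} {μ ν : Measure ℝ}
    (hμ : IsSpectralMeasure A ξ μ) (hν : IsSpectralMeasure A ξ ν) : μ = ν := by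
  obtain ⟨_, -, h1⟩ := hμ
  obtain ⟨_, -, h2⟩ := hν
  refine ext_of_forall_integral_eq_of_IsFiniteMeasure fun f => ?_
  have := (h1 f f.continuous).symm.trans (h2 f f.continuous)
  exact_mod_cast this

theorem exists_isSpectralMeasure {A : H →L[ℂ] H} (hA : IsSelfAdjoint A) (ξ : H) :
    ∃ μ : Measure ℝ, IsSpectralMeasure A ξ μ := by
  have hcomp : CompactSpace (spectrum ℝ A) :=
    isCompact_iff_compactSpace.1 (ContinuousFunctionalCalculus.isCompact_spectrum A)
  let L : CompactlySupportedContinuousMap (spectrum ℝ A) ℝ →ₗ[ℝ] ℝ :=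
    { toFun := fun f => (inner ℂ ξ (cfcHom hA f.toContinuousMap ξ) : ℂ).re
      map_add' := by
        intro f g
        have : (f + g).toContinuousMap = f.toContinuousMap + g.toContinuousMap := rfl
        rw [this, map_add, add_apply, inner_add_right, Complex.add_re]
      map_smul' := by
        intro c f
        have : (c • f).toContinuousMap = c • f.toContinuousMap := rfl
        rw [this, map_smul, smul_apply, inner_smul_right_eq_smul]
        simp }
  let Λ : CompactlySupportedContinuousMap (spectrum ℝ A) ℝ →ₚ[ℝ] ℝ :=
    PositiveLinearMap.mk₀ L (by
      intro f hf
      have h : 0 ≤ cfcHom hA f.toContinuousMap := by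
        rw [cfcHom_nonneg_iff]
        exact fun x => hf x
      rw [ContinuousLinearMap.nonneg_iff_isPositive] at h
      have := h.re_inner_nonneg_right ξ
      exact this)
  have hΛ := RealRMK.integral_rieszMeasure Λ
  set ρ := RealRMK.rieszMeasure Λ with hρ
  have hemb : MeasurableEmbedding ((↑) : spectrum ℝ A → ℝ) :=
    MeasurableEmbedding.subtype_coe (spectrum.isClosed A).measurableSet
  have hfin : IsFiniteMeasure ρ := by
    have : IsFiniteMeasureOnCompacts ρ := by
      rw [hρ]; unfold RealRMK.rieszMeasure; infer_instance
    exact ⟨isCompact_univ.measure_lt_top⟩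
  refine ⟨ρ.map (↑), inferInstance, ?_, fun f hf => ?_⟩
  · rw [hemb.map_apply]
    convert measure_empty (μ := ρ)
    ext x; simp
  · have hfs : IsSelfAdjoint (cfc f A) := cfc_predicate f A
    have him : (inner ℂ ξ (cfc f A ξ) : ℂ).im = 0 :=
      (ContinuousLinearMap.isSelfAdjoint_iff_isSymmetric.1 hfs).im_inner_self_apply ξ
    rw [hemb.integral_map]
    have := hΛ ⟨⟨fun x => f x, hf.comp continuous_subtype_val⟩, HasCompactSupport.of_compactSpace _⟩
    have e : cfc f A = cfcHom hA ⟨fun x => f x, hf.comp continuous_subtype_val⟩ :=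
      cfc_apply f A hA hf.continuousOn
    apply Complex.ext
    · rw [Complex.ofReal_re, e]
      exact this.symm
    · rw [Complex.ofReal_im, him]

/-- The spectral measure of a bounded self-adjoint operator `A` and a vector `ξ`. -/
noncomputable def spectralMeasure (A : H →L[ℂ] H) (hA : IsSelfAdjoint A) (ξ : H) : Measure ℝ :=
  Classical.choose (exists_isSpectralMeasure hA ξ)

theorem isSpectralMeasure_spectralMeasure (A : H →L[ℂ] H) (hA : IsSelfAdjoint A) (ξ : H) :
    IsSpectralMeasure A ξ (spectralMeasure A hA ξ) :=
  Classical.choose_spec (exists_isSpectralMeasure hA ξ)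

end

end Olshanski

namespace Olshanski

/-! ### Atoms of spectral measures, weak limits and Schur's lemma. -/

section HilbertSpace

variable {H : Type*} [NormedAddCommGroup H] [InnerProductSpace ℂ H]

/-! Write A_i for the weak limit of the transpositions of `i + 1` and `n`, P_i for the projection
onto its eigenspace for x, and c = μ({x}) = (P_0 ξ, ξ). The A_i commute, so the product of P_0, …,
P_{m-1} is the projection onto their joint eigenspace; let ξ_m be the image of ξ under it.

The numbers (π(e) ξ_m, ξ), for e in the symmetric group on m points, obey a recursion in m. If the
new point is fixed, the extra projection P_m contributes the factor c: the weak limit of the P_n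
commutes with the whole group, hence is a scalar by Schur's lemma, and on vectors fixed by the part
of K beyond m this limit is already attained (`inner_projP_of_isFixedAt`,
`matElt_decomposeFin_zero`). If the new point is joined to an old one by a transposition, that
transposition acts in the matrix element as some A_b with b < m, which gives the factor x
(`matElt_decomposeFin_succ`).

Sum these numbers against the sign character if x > 0 and the trivial character if x < 0. Each of
the m choices of an old point then contributes -|x|, so the sum is the product of c - k|x| over k <
m (`sum_signChar_matElt`). It is a positive multiple of the squared norm of a vector, hence
nonnegative for every m (`sum_inner_nonneg`). This forces c to be a natural multiple of |x|, since
otherwise all the factors would be positive. -/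

theorem starProjection_intertwine {K L : Submodule ℂ H} [K.HasOrthogonalProjection]
    [L.HasOrthogonalProjection] {U V : H →L[ℂ] H}
    (hUV : ∀ v w, inner ℂ (U v) w = inner ℂ v (V w)) (hU : ∀ v ∈ K, U v ∈ L)
    (hV : ∀ v ∈ L, V v ∈ K) (v : H) :
    U (K.starProjection v) = L.starProjection (U v) := by
  refine (Submodule.eq_starProjection_of_mem_of_inner_eq_zero
    (hU _ (K.starProjection_apply_mem v)) fun w hw => ?_).symm
  rw [← map_sub, hUV]
  exact K.starProjection_inner_eq_zero v _ (hV w hw)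

/-- The eigenspace of a bounded operator for a real number `x`. -/
def eigen (A : H →L[ℂ] H) (x : ℝ) : Submodule ℂ H :=
  (A - (x : ℂ) • (1 : H →L[ℂ] H)).ker

theorem mem_eigen {A : H →L[ℂ] H} {x : ℝ} {v : H} : v ∈ eigen A x ↔ A v = (x : ℂ) • v := by
  simp [eigen, sub_eq_zero]

theorem isClosed_eigen (A : H →L[ℂ] H) (x : ℝ) : IsClosed (eigen A x : Set H) :=
  (A - (x : ℂ) • (1 : H →L[ℂ] H)).isClosed_ker

variable [CompleteSpace H]

instance (A : H →L[ℂ] H) (x : ℝ) : (eigen A x).HasOrthogonalProjection :=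
  have := (isClosed_eigen A x).completeSpace_coe
  inferInstance

theorem cfc_sub_const {A : H →L[ℂ] H} (hA : IsSelfAdjoint A) (x : ℝ) :
    cfc (fun t : ℝ => t - x) A = A - (x : ℂ) • (1 : H →L[ℂ] H) := by
  rw [cfc_sub (fun t : ℝ => t) (fun _ => x) A, cfc_id' ℝ A, cfc_const x A,
    Algebra.algebraMap_eq_smul_one]
  rfl

/-- The functions decrease to the indicator of {x}. With D = A - x, the operators f_n(A) are the
identity on ker D, have norm at most 1, and satisfy ‖f_n(A) D‖ ≤ 1/n. Hence they tend strongly to 0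
on the closure of the range of D, the orthogonal complement of ker D. -/
theorem tendsto_cfc_apply {A : H →L[ℂ] H} (hA : IsSelfAdjoint A) (x : ℝ) (v : H) :
    Tendsto (fun n : ℕ => cfc (fun t : ℝ => (1 + (n : ℝ) ^ 2 * (t - x) ^ 2)⁻¹) A v) atTop
      (𝓝 ((eigen A x).starProjection v)) := by
  set f : ℕ → ℝ → ℝ := fun n t => (1 + (n : ℝ) ^ 2 * (t - x) ^ 2)⁻¹ with hf
  have hpos : ∀ (n : ℕ) (t : ℝ), 0 < 1 + (n : ℝ) ^ 2 * (t - x) ^ 2 := fun n t => by positivity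
  have hfc : ∀ n, Continuous (f n) := fun n =>
    Continuous.inv₀ (by fun_prop) fun t => (hpos n t).ne'
  have hD : cfc (fun t : ℝ => t - x) A = A - (x : ℂ) • (1 : H →L[ℂ] H) := cfc_sub_const hA x
  set D := A - (x : ℂ) • (1 : H →L[ℂ] H)
  have hfix : ∀ n, ∀ u ∈ eigen A x, cfc (f n) A u = u := by
    intro n u hu
    have hgc : Continuous fun t : ℝ => (n : ℝ) ^ 2 * (t - x) * f n t := by
      have := hfc n; fun_prop
    -- The identity 1 - f_n(t) = n² (t - x) f_n(t) · (t - x) shows that 1 - f_n(A) factors through D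
    -- and so kills u.
    have h1 : cfc (f n) A + cfc (fun t : ℝ => (n : ℝ) ^ 2 * (t - x) * f n t) A * D = 1 := by
      rw [← hD, ← cfc_mul _ _ A hgc.continuousOn (by fun_prop),
        ← cfc_add A _ _ (hfc n).continuousOn (by have := hfc n; fun_prop), ← cfc_const_one ℝ A]
      congr 1
      ext t
      have := (hpos n t).ne'
      simp only [hf]
      field_simp
    have h2 := congrArg (fun T : H →L[ℂ] H => T u) h1
    have hDu : D u = 0 := hu
    simpa [hDu] using h2
  have hsmall : ∀ (n : ℕ) (u : H), ‖cfc (f n) A (D u)‖ ≤ (n : ℝ)⁻¹ * ‖u‖ ∨ n = 0 := by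
    intro n u
    rcases Nat.eq_zero_or_pos n with hn | hn
    · exact Or.inr hn
    left
    have hn' : (0 : ℝ) < n := by exact_mod_cast hn
    have e : cfc (f n) A (D u) = (cfc (fun t : ℝ => f n t * (t - x)) A) u := by
      rw [cfc_mul _ _ A (hfc n).continuousOn (by fun_prop), hD]; rfl
    rw [e]
    refine ContinuousLinearMap.le_of_opNorm_le _ (norm_cfc_le (by positivity) fun t _ => ?_) u
    rw [Real.norm_eq_abs, abs_mul, abs_of_pos (inv_pos.2 (hpos n t)), inv_mul_le_iff₀ (hpos n t),
      ← div_eq_mul_inv, le_div_iff₀ hn', ← sq_abs (t - x)]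
    -- With s = |t - x|, the bound s f_n(t) ≤ 1/n amounts to ns ≤ 1 + n²s².
    nlinarith [sq_nonneg ((n : ℝ) * |t - x| - 1), abs_nonneg (t - x)]
  have hone : ∀ (n : ℕ) (u : H), ‖cfc (f n) A u‖ ≤ ‖u‖ := by
    intro n u
    refine (ContinuousLinearMap.le_of_opNorm_le _
      (norm_cfc_le zero_le_one fun t _ => ?_) u).trans_eq (one_mul _)
    rw [Real.norm_eq_abs, abs_of_pos (inv_pos.2 (hpos n t))]
    exact inv_le_one_of_one_le₀ (by have : 0 ≤ (n : ℝ) ^ 2 * (t - x) ^ 2 := by positivity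
                                    linarith)
  set p := (eigen A x).starProjection v with hp
  have hq : v - p ∈ closure (Set.range D) := by
    have h1 : v - p ∈ (eigen A x)ᗮ := (eigen A x).sub_starProjection_mem_orthogonal v
    have hDs : IsSelfAdjoint D := hD ▸ cfc_predicate _ A
    have h2 : (eigen A x) = (D.range)ᗮ := by
      rw [ContinuousLinearMap.orthogonal_range, hDs.adjoint_eq]; rfl
    rw [h2, Submodule.orthogonal_orthogonal_eq_closure] at h1
    have h3 : Set.range D = (D.range : Set H) := by ext; simp
    rw [h3]
    exact h1
  have hq0 : Tendsto (fun n => cfc (f n) A (v - p)) atTop (𝓝 0) := by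
    rw [Metric.tendsto_atTop]
    intro ε hε
    obtain ⟨_, ⟨u, rfl⟩, hu⟩ := Metric.mem_closure_iff.1 hq (ε / 2) (by positivity)
    obtain ⟨N, hN⟩ := exists_nat_gt (2 * ‖u‖ / ε)
    refine ⟨N + 1, fun n hn => ?_⟩
    rw [dist_zero_right]
    rw [dist_eq_norm] at hu
    have hn0 : n ≠ 0 := by omega
    have hn' : (0 : ℝ) < n := by positivity
    have hNn : (N : ℝ) ≤ n := by exact_mod_cast (by omega : N ≤ n)
    have h1 : ‖cfc (f n) A (D u)‖ ≤ (n : ℝ)⁻¹ * ‖u‖ := (hsmall n u).resolve_right hn0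
    have h2 : (n : ℝ)⁻¹ * ‖u‖ < ε / 2 := by
      rw [inv_mul_lt_iff₀ hn']
      rw [div_lt_iff₀ hε] at hN
      nlinarith
    have h3 := hone n (v - p - D u)
    have h4 : cfc (f n) A (v - p) = cfc (f n) A (v - p - D u) + cfc (f n) A (D u) := by
      rw [← map_add]; simp
    rw [h4]
    refine (norm_add_le _ _).trans_lt ?_
    linarith
  have := hq0.add_const p
  rw [zero_add] at this
  refine this.congr fun n => ?_
  rw [map_sub, hfix n p ((eigen A x).starProjection_apply_mem v), sub_add_cancel]

/-- The same functions of t tend pointwise to the indicator of {x}, so dominated convergence on the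
measure side matches the strong limit on the operator side. -/
theorem inner_starProjection_eigen {A : H →L[ℂ] H} (hA : IsSelfAdjoint A) {ξ : H} {μ : Measure ℝ}
    (hμ : IsSpectralMeasure A ξ μ) (x : ℝ) :
    inner ℂ ξ ((eigen A x).starProjection ξ) = ((μ {x}).toReal : ℂ) := by
  obtain ⟨hfin, -, hint⟩ := hμ
  have h1 := ((innerSL ℂ ξ).continuous.tendsto _).comp (tendsto_cfc_apply hA x ξ)
  simp only [Function.comp_def, innerSL_apply_apply] at h1
  refine tendsto_nhds_unique h1 ?_
  have hpos : ∀ (n : ℕ) (t : ℝ), 0 < 1 + (n : ℝ) ^ 2 * (t - x) ^ 2 := fun n t => by positivity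
  have hfc : ∀ n : ℕ, Continuous fun t : ℝ => (1 + (n : ℝ) ^ 2 * (t - x) ^ 2)⁻¹ := fun n =>
    Continuous.inv₀ (by fun_prop) fun t => (hpos n t).ne'
  have h2 : Tendsto (fun n : ℕ => ∫ t, (1 + (n : ℝ) ^ 2 * (t - x) ^ 2)⁻¹ ∂μ) atTop
      (𝓝 (∫ t, Set.indicator {x} (fun _ => (1 : ℝ)) t ∂μ)) := by
    refine tendsto_integral_of_dominated_convergence (fun _ => 1)
      (fun n => (hfc n).aestronglyMeasurable) (integrable_const _)
      (fun n => Eventually.of_forall fun t => ?_) (Eventually.of_forall fun t => ?_)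
    · rw [Real.norm_eq_abs, abs_of_pos (inv_pos.2 (hpos n t))]
      exact inv_le_one_of_one_le₀ (by have : 0 ≤ (n : ℝ) ^ 2 * (t - x) ^ 2 := by positivity
                                      linarith)
    · by_cases ht : t = x
      · simp [ht]
      · rw [Set.indicator_of_notMem (by simpa using ht)]
        have h0 : 0 < (t - x) ^ 2 := by have := sub_ne_zero.2 ht; positivity
        refine Tendsto.inv_tendsto_atTop (tendsto_atTop_add_const_left _ _ ?_)
        exact ((tendsto_pow_atTop two_ne_zero).comp
          tendsto_natCast_atTop_atTop).atTop_mul_const h0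
  rw [integral_indicator_const _ (measurableSet_singleton x)] at h2
  simp only [smul_eq_mul, mul_one] at h2
  refine ((Complex.continuous_ofReal.tendsto _).comp h2).congr fun n => ?_
  exact (hint _ (hfc n)).symm

/-- Bounded scalars converge along an ultrafilter. The limits form a bounded sesquilinear form,
hence an operator. This supplies a weak limit of the projections before their convergence is known.
-/
theorem exists_ultrafilter_lim (T : ℕ → H →L[ℂ] H) (hT : ∀ n v, ‖T n v‖ ≤ ‖v‖) :
    ∃ Θ : H →L[ℂ] H, ∀ v w, Tendsto (fun n => inner ℂ (T n v) w) (hyperfilter ℕ)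
      (𝓝 (inner ℂ (Θ v) w)) := by
  have hb : ∀ n v w, ‖(inner ℂ (T n v) w : ℂ)‖ ≤ ‖v‖ * ‖w‖ := fun n v w =>
    (norm_inner_le_norm _ _).trans (by gcongr; exact hT n v)
  have hex : ∀ v w, ∃ z : ℂ, Tendsto (fun n => inner ℂ (T n v) w) (hyperfilter ℕ) (𝓝 z) := by
    intro v w
    obtain ⟨z, -, hz⟩ := (isCompact_closedBall (0 : ℂ) (‖v‖ * ‖w‖)).ultrafilter_le_nhds
      ((hyperfilter ℕ).map fun n => inner ℂ (T n v) w) (by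
        rw [le_principal_iff]
        exact Eventually.of_forall (f := (hyperfilter ℕ : Filter ℕ)) fun n => by
          simpa using hb n v w)
    exact ⟨z, hz⟩
  choose B hB using hex
  let B₁ : H →ₗ⋆[ℂ] H →ₗ[ℂ] ℂ := LinearMap.mk₂'ₛₗ (starRingEnd ℂ) (RingHom.id ℂ) B
    (fun v v' w => tendsto_nhds_unique (hB _ _)
      (by simpa only [map_add, inner_add_left] using (hB v w).add (hB v' w)))
    (fun c v w => tendsto_nhds_unique (hB _ _)
      (by simpa only [map_smul, inner_smul_left, smul_eq_mul] using
        (hB v w).const_mul (starRingEnd ℂ c)))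
    (fun v w w' => tendsto_nhds_unique (hB _ _)
      (by simpa only [inner_add_right] using (hB v w).add (hB v w')))
    (fun c v w => tendsto_nhds_unique (hB _ _)
      (by simpa only [inner_smul_right, smul_eq_mul, RingHom.id_apply] using
        (hB v w).const_mul c))
  let B₂ : H →L⋆[ℂ] H →L[ℂ] ℂ := B₁.mkContinuous₂ 1 (fun v w => by
    rw [one_mul]
    exact le_of_tendsto (hB v w).norm (Eventually.of_forall fun n => hb n v w))
  refine ⟨InnerProductSpace.continuousLinearMapOfBilin B₂, fun v w => ?_⟩
  rw [InnerProductSpace.continuousLinearMapOfBilin_apply]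
  exact hB v w

/-- Schur's lemma for self-adjoint operators. -/
theorem IsIrreducibleRep.eq_smul_one {π : GD →* unitary (H →L[ℂ] H)} (hπ : IsIrreducibleRep π)
    {Θ : H →L[ℂ] H} (hΘ : IsSelfAdjoint Θ)
    (hcomm : ∀ g, Commute Θ (π g : H →L[ℂ] H)) :
    ∃ c : ℝ, Θ = (c : ℂ) • (1 : H →L[ℂ] H) := by
  obtain ⟨hnt, hirr⟩ := hπ
  -- The kernel of f(Θ) is closed and invariant, so it is 0 or everything; it contains the range of
  -- g(Θ).
  have hzero : ∀ f g : ℝ → ℝ, Continuous f → Continuous g → (∀ t, f t * g t = 0) →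
      cfc f Θ = 0 ∨ cfc g Θ = 0 := by
    intro f g hf hg hfg
    have hmul : cfc f Θ * cfc g Θ = 0 := by
      rw [← cfc_mul _ _ Θ hf.continuousOn hg.continuousOn]
      simp [hfg]
    have hinv : ∀ g : GD, ∀ v ∈ (cfc f Θ).ker, (π g : H →L[ℂ] H) v ∈ (cfc f Θ).ker := by
      intro k v hv
      have h1 := congrArg (fun T : H →L[ℂ] H => T v) ((hcomm k).cfc_real f).eq
      have hv' : cfc f Θ v = 0 := hv
      change cfc f Θ ((π k : H →L[ℂ] H) v) = 0
      simpa [hv'] using h1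
    rcases hirr (cfc f Θ).ker (cfc f Θ).isClosed_ker hinv with h | h
    · right
      ext v
      have : cfc g Θ v ∈ (cfc f Θ).ker := congrArg (fun T : H →L[ℂ] H => T v) hmul
      rw [h] at this
      simpa using this
    · left
      ext v
      have : v ∈ (cfc f Θ).ker := h ▸ Submodule.mem_top
      simpa using this
  have hbump : ∀ c ∈ spectrum ℝ Θ, ∀ r > 0, cfc (fun t => max 0 (r - |t - c|)) Θ ≠ 0 := by
    intro c hc r hr h0
    have h1 := (norm_cfc_le_iff (𝕜 := ℝ) (fun t => max 0 (r - |t - c|)) Θ le_rfl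
      (by fun_prop)).1 (by rw [h0]; simp) c hc
    simp [hr.le, hr.ne'] at h1
  obtain ⟨c, hc⟩ : (spectrum ℝ Θ).Nonempty := ContinuousFunctionalCalculus.spectrum_nonempty Θ hΘ
  refine ⟨c, ?_⟩
  have hsp : ∀ d ∈ spectrum ℝ Θ, d = c := by
    intro d hd
    by_contra hne
    have hr : 0 < |d - c| / 2 := by have := abs_pos.2 (sub_ne_zero.2 hne); positivity
    -- Two distinct spectral points would carry bumps with product zero, neither of which vanishes
    -- on the spectrum.
    have hmul : ∀ t, max 0 (|d - c| / 2 - |t - c|) * max 0 (|d - c| / 2 - |t - d|) = 0 := by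
      intro t
      have := abs_sub_le d t c
      rw [abs_sub_comm d t] at this
      rcases le_total (|d - c| / 2) |t - c| with h | h
      · rw [max_eq_left (by linarith), zero_mul]
      · rw [max_eq_left (b := |d - c| / 2 - |t - d|) (by linarith), mul_zero]
    rcases hzero _ _ (by fun_prop) (by fun_prop) hmul with h | h
    · exact hbump c hc _ hr h
    · exact hbump d hd _ hr h
  have h1 : cfc (fun t : ℝ => t - c) Θ = 0 := by
    rw [cfc_congr (g := fun _ => (0 : ℝ)) fun d hd => by simp [hsp d hd], cfc_const_zero]
  rw [cfc_sub_const hΘ] at h1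
  exact sub_eq_zero.1 h1

end HilbertSpace

/-! ### Elements of the group -/

/-- The transposition `(i + 1, j + 1)`. -/
def tr (i j : ℕ) : GD :=
  ⟨Equiv.swap ((i : ℤ) + 1) ((j : ℤ) + 1), swap_mem_GD (by positivity) (by positivity)⟩

theorem tr_zero (n : ℕ) : tr 0 n = transp n := Subtype.ext (by simp [tr, transp])

theorem tr_self (i : ℕ) : tr i i = 1 := Subtype.ext (Equiv.swap_self _)

theorem tr_inv (i j : ℕ) : (tr i j)⁻¹ = tr i j := Subtype.ext (Equiv.swap_inv _ _)

theorem mul_tr {g : GD} {i j k l : ℕ} (hi : g.1 (i + 1) = j + 1) (hk : g.1 (k + 1) = l + 1) :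
    g * tr i k = tr j l * g :=
  Subtype.ext ((Equiv.mul_swap_eq_swap_mul g.1 _ _).trans (by rw [hi, hk]; rfl))

theorem eventually_apply_eq (g : GD) : ∀ᶠ n : ℕ in atTop, g.1 (n + 1) = n + 1 := by
  obtain ⟨N, hN⟩ := (g.2.1.image fun i : ℤ => i.natAbs).bddAbove
  filter_upwards [eventually_ge_atTop N] with n hn
  by_contra h
  have := hN (Set.mem_image_of_mem _ h)
  omega

theorem exists_mem_KD_apply {m x y : ℕ} (hx : m ≤ x) (hy : m ≤ y) :
    ∃ k ∈ KD, (∀ i : ℤ, |i| ≤ m → k.1 i = i) ∧ k.1 (x + 1) = y + 1 := by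
  obtain ⟨s, hs⟩ : ∃ s : Equiv.Perm ℤ, ∀ i : ℤ, s i =
      if i = x + 1 then (y : ℤ) + 1 else if i = y + 1 then (x : ℤ) + 1 else
        if i = -(x + 1) then -((y : ℤ) + 1) else if i = -(y + 1) then -((x : ℤ) + 1) else i := by
    refine ⟨Equiv.swap ((x : ℤ) + 1) (y + 1) * Equiv.swap (-((x : ℤ) + 1)) (-(y + 1)), fun i => ?_⟩
    simp only [Equiv.Perm.mul_apply, Equiv.swap_apply_def]
    split_ifs <;> omega
  have hG : s ∈ GD := by
    refine ⟨(Set.toFinite {(x : ℤ) + 1, (y : ℤ) + 1, -((x : ℤ) + 1), -((y : ℤ) + 1)}).subset ?_,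
      ?_, fun i => ?_⟩
    · intro i hi
      by_contra h
      simp only [Set.mem_insert_iff, Set.mem_singleton_iff, not_or] at h
      exact hi (by rw [hs, if_neg h.1, if_neg h.2.1, if_neg h.2.2.1, if_neg h.2.2.2])
    · rw [hs]; split_ifs <;> omega
    · rw [hs]; split_ifs <;> omega
  refine ⟨⟨s, hG⟩, fun i => ?_, fun i hi => ?_, (hs _).trans (if_pos rfl)⟩
  · change s (-i) = -s i
    rw [hs, hs]; split_ifs <;> omega
  · rw [abs_le] at hi
    change s i = i
    rw [hs]; split_ifs <;> omega

/-- The embedding of `Fin m` onto `{1, …, m}` that reverses the order. -/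
def revEmb (m : ℕ) : Fin m ↪ ℤ :=
  ⟨fun i => (m : ℤ) - i, fun i j h => Fin.ext (by simp only at h; omega)⟩

theorem revEmb_apply {m : ℕ} (i : Fin m) : revEmb m i = (m : ℤ) - i := rfl

theorem mem_range_revEmb {m : ℕ} {z : ℤ} : z ∈ Set.range (revEmb m) ↔ 0 < z ∧ z ≤ m := by
  constructor
  · rintro ⟨i, rfl⟩
    have := i.2
    rw [revEmb_apply]
    omega
  · rintro ⟨h1, h2⟩
    exact ⟨⟨(m - z).toNat, by omega⟩, by simp [revEmb_apply]; omega⟩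

/-- The finite symmetric group as the group of permutations of `{1, …, m}`. -/
noncomputable def permHom (m : ℕ) : Equiv.Perm (Fin m) →* GD :=
  (Equiv.Perm.viaEmbeddingHom (revEmb m)).codRestrict GD (by
    intro e
    rw [Equiv.Perm.viaEmbeddingHom_apply]
    have hout : ∀ z ∉ Set.range (revEmb m), e.viaEmbedding (revEmb m) z = z :=
      e.viaEmbedding_apply_of_notMem (revEmb m)
    refine ⟨(Set.finite_range (revEmb m)).subset fun z hz => ?_, hout 0 ?_, fun z => ?_⟩
    · by_contra h
      exact hz (hout z h)
    · rw [mem_range_revEmb]; omega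
    · by_cases hz : z ∈ Set.range (revEmb m)
      · obtain ⟨i, rfl⟩ := hz
        rw [Equiv.Perm.viaEmbedding_apply]
        exact iff_of_true (mem_range_revEmb.1 ⟨_, rfl⟩).1 (mem_range_revEmb.1 ⟨_, rfl⟩).1
      · rw [hout z hz])

theorem permHom_apply {m : ℕ} (e : Equiv.Perm (Fin m)) (i : Fin m) :
    (permHom m e).1 (revEmb m i) = revEmb m (e i) :=
  e.viaEmbedding_apply (revEmb m) i

theorem permHom_apply_of_notMem {m : ℕ} (e : Equiv.Perm (Fin m)) {z : ℤ} (hz : ¬(0 < z ∧ z ≤ m)) :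
    (permHom m e).1 z = z :=
  e.viaEmbedding_apply_of_notMem (revEmb m) z (by rwa [mem_range_revEmb])

theorem exists_permHom_apply {m : ℕ} (e : Equiv.Perm (Fin m)) {i : ℕ} (hi : i < m) :
    ∃ j < m, (permHom m e).1 (j + 1) = i + 1 := by
  obtain ⟨a, ha⟩ := (mem_range_revEmb (m := m) (z := (i : ℤ) + 1)).2 (by omega)
  obtain ⟨h1, h2⟩ := (mem_range_revEmb (m := m) (z := revEmb m (e.symm a))).1 ⟨_, rfl⟩
  refine ⟨(revEmb m (e.symm a) - 1).toNat, by omega, ?_⟩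
  rw [Int.toNat_of_nonneg (by omega), sub_add_cancel, permHom_apply, Equiv.apply_symm_apply, ha]

/-- `decomposeFin` adds its new point at 0 and shifts the old ones by `succ`. Because `revEmb`
reverses the order, the old points keep their places in ℤ and the new one is m + 1. -/
theorem permHom_decomposeFin_val {m : ℕ} (p : Fin (m + 1)) (e : Equiv.Perm (Fin m)) :
    (permHom (m + 1) (Equiv.Perm.decomposeFin.symm (p, e))).1 =
      Equiv.swap (revEmb (m + 1) 0) (revEmb (m + 1) p) * (permHom m e).1 := by
  ext z
  rw [Equiv.Perm.mul_apply]
  by_cases hz : 0 < z ∧ z ≤ (m + 1 : ℕ)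
  · obtain ⟨i, rfl⟩ := mem_range_revEmb.2 hz
    rw [permHom_apply]
    refine Fin.cases ?_ (fun j => ?_) i
    · rw [Equiv.Perm.decomposeFin_symm_apply_zero, permHom_apply_of_notMem, Equiv.swap_apply_left]
      simp [revEmb_apply]
    · have hsucc : ∀ j : Fin m, revEmb (m + 1) j.succ = revEmb m j := fun j => by
        simp [revEmb_apply]
      rw [Equiv.Perm.decomposeFin_symm_apply_succ, hsucc, permHom_apply, ← hsucc,
        (revEmb (m + 1)).injective.swap_apply]
  · have h0 : ∀ i, z ≠ revEmb (m + 1) i := fun i h => hz (mem_range_revEmb.1 ⟨i, h.symm⟩)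
    rw [permHom_apply_of_notMem _ hz, permHom_apply_of_notMem _ (by omega),
      Equiv.swap_apply_of_ne_of_ne (h0 _) (h0 _)]

theorem permHom_decomposeFin_zero {m : ℕ} (e : Equiv.Perm (Fin m)) :
    permHom (m + 1) (Equiv.Perm.decomposeFin.symm (0, e)) = permHom m e :=
  Subtype.ext (by rw [permHom_decomposeFin_val, Equiv.swap_self]; rfl)

theorem permHom_decomposeFin_succ {m : ℕ} (a : Fin m) (e : Equiv.Perm (Fin m)) :
    permHom (m + 1) (Equiv.Perm.decomposeFin.symm (a.succ, e)) = tr (m - 1 - a) m * permHom m e := by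
  have ha := a.2
  apply Subtype.ext
  rw [permHom_decomposeFin_val, Equiv.swap_comm]
  have h1 : revEmb (m + 1) a.succ = ((m - 1 - a : ℕ) : ℤ) + 1 := by
    rw [revEmb_apply, Fin.val_succ]; omega
  have h2 : revEmb (m + 1) 0 = (m : ℤ) + 1 := by simp [revEmb_apply]
  rw [h1, h2]
  rfl

/-! ### Weak limits of transpositions and their matrix elements. -/

section

variable {H : Type*} [NormedAddCommGroup H] [InnerProductSpace ℂ H] [CompleteSpace H]

theorem rep_mul_apply (π : GD →* unitary (H →L[ℂ] H)) (g h : GD) (v : H) :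
    (π (g * h) : H →L[ℂ] H) v = (π g : H →L[ℂ] H) ((π h : H →L[ℂ] H) v) := by
  rw [map_mul]; rfl

theorem inner_rep_left (π : GD →* unitary (H →L[ℂ] H)) (g : GD) (v w : H) :
    inner ℂ ((π g : H →L[ℂ] H) v) w = inner ℂ v ((π g⁻¹ : H →L[ℂ] H) w) := by
  rw [← inner_rep π g⁻¹, ← rep_mul_apply]
  simp

theorem inner_tr_left (π : GD →* unitary (H →L[ℂ] H)) (i j : ℕ) (v w : H) :
    inner ℂ ((π (tr i j) : H →L[ℂ] H) v) w = inner ℂ v ((π (tr i j) : H →L[ℂ] H) w) := by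
  rw [inner_rep_left, tr_inv]

/-- The limit of `π((i + 1, n))` in the weak operator topology, as `n → ∞`. -/
noncomputable def opA (π : GD →* unitary (H →L[ℂ] H)) (hπ : IsSpherical π) (i : ℕ) : H →L[ℂ] H :=
  (π (tr 0 i) : H →L[ℂ] H) * opA₁ π hπ * (π (tr 0 i) : H →L[ℂ] H)

variable {π : GD →* unitary (H →L[ℂ] H)} (hπ : IsSpherical π)

theorem opA_zero : opA π hπ 0 = opA₁ π hπ := by
  simp [opA, tr_self]

/-- For n > i, conjugating `tr 0 n` by `tr 0 i` gives `tr i n`. -/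
theorem tendsto_inner_tr (i : ℕ) (v w : H) :
    Tendsto (fun n => inner ℂ ((π (tr i n) : H →L[ℂ] H) v) w) atTop
      (𝓝 (inner ℂ (opA π hπ i v) w)) := by
  have h := isWeakLimit_opA₁ π hπ ((π (tr 0 i) : H →L[ℂ] H) v) ((π (tr 0 i) : H →L[ℂ] H) w)
  rw [← inner_tr_left] at h
  refine h.congr' ?_
  filter_upwards [eventually_gt_atTop i] with n hn
  rw [← inner_tr_left, ← rep_mul_apply, ← rep_mul_apply, ← tr_zero]
  congr 3
  have h1 : tr 0 i * tr 0 n = tr i n * tr 0 i := by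
    refine mul_tr ?_ ?_
    · exact Equiv.swap_apply_left _ _
    · exact Equiv.swap_apply_of_ne_of_ne (by push_cast; omega) (by omega)
  have h2 : tr 0 i * tr 0 i = 1 := by nth_rewrite 1 [← tr_inv]; exact inv_mul_cancel _
  rw [h1, mul_assoc, h2, mul_one]

theorem inner_opA_left (i : ℕ) (v w : H) :
    inner ℂ (opA π hπ i v) w = inner ℂ v (opA π hπ i w) := by
  have h1 := tendsto_inner_tr hπ i v w
  have h2 := (Complex.continuous_conj.tendsto _).comp (tendsto_inner_tr hπ i w v)
  simp only [Function.comp_def, inner_conj_symm] at h2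
  exact tendsto_nhds_unique h1 (h2.congr fun n => (inner_tr_left π i n v w).symm)

theorem rep_opA {g : GD} {i j : ℕ} (hg : g.1 (i + 1) = j + 1) (v : H) :
    (π g : H →L[ℂ] H) (opA π hπ i v) = opA π hπ j ((π g : H →L[ℂ] H) v) := by
  refine ext_inner_right ℂ fun w => ?_
  rw [inner_rep_left]
  refine tendsto_nhds_unique (tendsto_inner_tr hπ i v _)
    ((tendsto_inner_tr hπ j ((π g : H →L[ℂ] H) v) w).congr' ?_)
  filter_upwards [eventually_apply_eq g] with n hn
  rw [← inner_rep_left, ← rep_mul_apply, ← rep_mul_apply, mul_tr hg hn]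

/-- For n ≠ j the transposition `tr i n` fixes j + 1, so it commutes with `opA π hπ j`; the limit in
n preserves this. -/
theorem opA_comm {i j : ℕ} (hij : i ≠ j) (v : H) :
    opA π hπ i (opA π hπ j v) = opA π hπ j (opA π hπ i v) := by
  refine ext_inner_right ℂ fun w => ?_
  rw [inner_opA_left hπ j]
  refine tendsto_nhds_unique (tendsto_inner_tr hπ i _ w)
    ((tendsto_inner_tr hπ i v (opA π hπ j w)).congr' ?_)
  filter_upwards [eventually_ne_atTop j] with n hn
  rw [← inner_opA_left hπ j, rep_opA hπ (j := j)]
  exact Equiv.swap_apply_of_ne_of_ne (by omega) (by omega)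

/-! ### Vectors fixed by the elements of `KD` that fix `-m, …, m` -/

theorem IsFixedAt.of_comm {m : ℕ} {v : H} (hv : IsFixedAt π m v) {B : H →L[ℂ] H}
    (hB : ∀ k ∈ KD, (∀ i : ℤ, |i| ≤ m → k.1 i = i) → ∀ u,
      (π k : H →L[ℂ] H) (B u) = B ((π k : H →L[ℂ] H) u)) : IsFixedAt π m (B v) := fun k hk hi => by
  rw [hB k hk hi, hv k hk hi]

theorem IsFixedAt.rep {m : ℕ} {v : H} (hv : IsFixedAt π m v) {g : GD}
    (hg : ∀ z : ℤ, ¬(0 < z ∧ z ≤ m) → g.1 z = z) : IsFixedAt π m ((π g : H →L[ℂ] H) v) := by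
  refine hv.of_comm fun k _ hi u => ?_
  have hcomm : k * g = g * k := by
    apply Subtype.ext
    apply Equiv.Perm.Disjoint.commute
    intro z
    by_cases hz : 0 < z ∧ z ≤ m
    · exact Or.inl (hi z (abs_le.2 ⟨by omega, hz.2⟩))
    · exact Or.inr (hg z hz)
  rw [← rep_mul_apply, ← rep_mul_apply, hcomm]

/-- An element of `KD` that fixes -m, …, m and sends m + 1 to n + 1 conjugates `tr i m` to `tr i n`
and fixes both vectors. The matrix element is thus constant for n ≥ m and equals its limit. -/
theorem IsFixedAt.inner_tr {m i : ℕ} {v w : H} (hi : i < m) (hv : IsFixedAt π m v)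
    (hw : IsFixedAt π m w) :
    inner ℂ ((π (tr i m) : H →L[ℂ] H) v) w = inner ℂ (opA π hπ i v) w := by
  refine tendsto_nhds_unique (tendsto_const_nhds.congr' ?_) (tendsto_inner_tr hπ i v w)
  filter_upwards [eventually_ge_atTop m] with n hn
  obtain ⟨k, hk, hkm, hkn⟩ := exists_mem_KD_apply (m := m) le_rfl hn
  have hki : k.1 (i + 1) = i + 1 := hkm _ (abs_le.2 ⟨by omega, by omega⟩)
  rw [← inner_rep π k, ← rep_mul_apply, mul_tr hki hkn, rep_mul_apply, hv k hk hkm, hw k hk hkm]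

/-! ### The spectral projections -/

variable (x : ℝ)

/-- The spectral projection of `opA π hπ i` for the point `x`. -/
noncomputable def projP (i : ℕ) : H →L[ℂ] H := (eigen (opA π hπ i) x).starProjection

theorem projP_eq_self {i : ℕ} {v : H} : projP hπ x i v = v ↔ opA π hπ i v = (x : ℂ) • v := by
  rw [projP, Submodule.starProjection_eq_self_iff, mem_eigen]

theorem opA_projP (i : ℕ) (v : H) : opA π hπ i (projP hπ x i v) = (x : ℂ) • projP hπ x i v :=
  mem_eigen.1 ((eigen (opA π hπ i) x).starProjection_apply_mem v)

theorem inner_projP_left (i : ℕ) (v w : H) :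
    inner ℂ (projP hπ x i v) w = inner ℂ v (projP hπ x i w) :=
  (eigen (opA π hπ i) x).inner_starProjection_left_eq_right v w

theorem rep_projP {g : GD} {i j : ℕ} (hg : g.1 (i + 1) = j + 1) (v : H) :
    (π g : H →L[ℂ] H) (projP hπ x i v) = projP hπ x j ((π g : H →L[ℂ] H) v) := by
  have hg' : (g⁻¹).1 (j + 1) = i + 1 := by
    change g.1⁻¹ _ = _
    rw [Equiv.Perm.inv_eq_iff_eq, hg]
  refine starProjection_intertwine (inner_rep_left π g) (fun u hu => ?_) (fun u hu => ?_) v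
  · rw [mem_eigen] at hu ⊢
    rw [← rep_opA hπ hg, hu, map_smul]
  · rw [mem_eigen] at hu ⊢
    rw [← rep_opA hπ hg', hu, map_smul]

theorem opA_projP_comm {i j : ℕ} (hij : i ≠ j) (v : H) :
    opA π hπ i (projP hπ x j v) = projP hπ x j (opA π hπ i v) := by
  have h : ∀ u ∈ eigen (opA π hπ j) x, opA π hπ i u ∈ eigen (opA π hπ j) x := fun u hu => by
    rw [mem_eigen] at hu ⊢
    rw [opA_comm hπ hij.symm, hu, map_smul]
  exact starProjection_intertwine (inner_opA_left hπ i) h h v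

/-- The weak limit of the projections `projP hπ x n` is a scalar. -/
theorem inner_projP_of_isFixedAt {ξ : H} (hξ : IsSphericalVector π ξ) {c : ℝ}
    (hc : inner ℂ ξ (projP hπ x 0 ξ) = (c : ℂ)) {m : ℕ} {u : H} (hu : IsFixedAt π m u) :
    inner ℂ u (projP hπ x m ξ) = (c : ℂ) * inner ℂ u ξ := by
  obtain ⟨Θ, hΘ⟩ := exists_ultrafilter_lim (projP hπ x) fun n v =>
    (eigen (opA π hπ n) x).norm_starProjection_apply_le v
  have hle : ((hyperfilter ℕ : Ultrafilter ℕ) : Filter ℕ) ≤ atTop :=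
    Nat.hyperfilter_le_atTop
  have hsymm : ∀ v w, inner ℂ (Θ v) w = inner ℂ v (Θ w) := by
    intro v w
    have h2 := (Complex.continuous_conj.tendsto _).comp (hΘ w v)
    simp only [Function.comp_def, inner_conj_symm] at h2
    exact tendsto_nhds_unique (hΘ v w) (h2.congr fun n => (inner_projP_left hπ x n v w).symm)
  -- Each g fixes n + 1 for large n, and then commutes with `projP hπ x n`.
  have hcomm : ∀ g, Commute Θ (π g : H →L[ℂ] H) := by
    intro g
    ext v
    refine ext_inner_right ℂ fun w => ?_
    change inner ℂ (Θ ((π g : H →L[ℂ] H) v)) w = inner ℂ ((π g : H →L[ℂ] H) (Θ v)) w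
    rw [inner_rep_left]
    refine tendsto_nhds_unique ((hΘ _ _).congr' (hle ?_)) (hΘ v _)
    filter_upwards [eventually_apply_eq g] with n hn
    rw [← rep_projP hπ x hn, inner_rep_left]
  obtain ⟨d, hd⟩ := hπ.1.eq_smul_one
    (ContinuousLinearMap.isSelfAdjoint_iff_isSymmetric.2 hsymm) hcomm
  -- Conjugation by `KD` makes the matrix element independent of n ≥ l, so its value at l is the
  -- limit.
  have key : ∀ {l : ℕ} {w : H}, IsFixedAt π l w →
      inner ℂ (projP hπ x l ξ) w = (d : ℂ) * inner ℂ ξ w := by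
    intro l w hw
    have h1 := hΘ ξ w
    rw [hd] at h1
    simp only [smul_apply, inner_smul_left, Complex.conj_ofReal] at h1
    refine tendsto_nhds_unique (tendsto_const_nhds.congr' (hle ?_)) h1
    filter_upwards [eventually_ge_atTop l] with n hn
    obtain ⟨k, hk, hkl, hkn⟩ := exists_mem_KD_apply (m := l) le_rfl hn
    rw [← inner_rep π k, rep_projP hπ x hkn, hξ.2 k hk, hw k hk hkl]
  -- The case l = 0, w = ξ identifies the scalar.
  have hcd : (c : ℂ) = d := by
    rw [← hc, ← inner_projP_left, key (w := ξ) fun k hk _ => hξ.2 k hk,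
      inner_self_eq_norm_sq_to_K, hξ.1]
    simp
  rw [← inner_conj_symm, key hu, map_mul, inner_conj_symm, Complex.conj_ofReal, hcd]

/-- The common eigenvectors of the first `m` operators `opA π hπ i`. -/
noncomputable def jointEigen (m : ℕ) : Submodule ℂ H := ⨅ i : Fin m, eigen (opA π hπ i) x

theorem mem_jointEigen {m : ℕ} {v : H} :
    v ∈ jointEigen hπ x m ↔ ∀ i < m, opA π hπ i v = (x : ℂ) • v := by
  simp only [jointEigen, Submodule.mem_iInf, mem_eigen]
  exact ⟨fun h i hi => h ⟨i, hi⟩, fun h i => h i i.2⟩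

instance (m : ℕ) : (jointEigen hπ x m).HasOrthogonalProjection := by
  have hcl : IsClosed (jointEigen hπ x m : Set H) := by
    rw [jointEigen, Submodule.coe_iInf]
    exact isClosed_iInter fun i => isClosed_eigen _ x
  have := hcl.completeSpace_coe
  infer_instance

/-- The projection onto `jointEigen hπ x m`. -/
noncomputable def projJ (m : ℕ) : H →L[ℂ] H := (jointEigen hπ x m).starProjection

theorem projJ_mem (m : ℕ) (v : H) : projJ hπ x m v ∈ jointEigen hπ x m :=
  (jointEigen hπ x m).starProjection_apply_mem v

theorem projJ_zero (v : H) : projJ hπ x 0 v = v :=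
  (jointEigen hπ x 0).starProjection_eq_self_iff.2 ((mem_jointEigen hπ x).2 (by simp))

theorem projJ_succ (m : ℕ) (v : H) : projJ hπ x (m + 1) v = projP hπ x m (projJ hπ x m v) := by
  refine Submodule.eq_starProjection_of_mem_of_inner_eq_zero ?_ fun w hw => ?_
  · rw [mem_jointEigen]
    intro i hi
    rcases (Nat.lt_succ_iff.1 hi).lt_or_eq with h | rfl
    · rw [opA_projP_comm hπ x h.ne, (mem_jointEigen hπ x).1 (projJ_mem hπ x m v) i h, map_smul]
    · exact opA_projP hπ x i _
  · rw [mem_jointEigen] at hw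
    have h1 : w ∈ jointEigen hπ x m := (mem_jointEigen hπ x).2 fun i hi => hw i (by omega)
    rw [inner_sub_left, inner_projP_left, (projP_eq_self hπ x).2 (hw m (by omega)),
      ← inner_sub_left]
    exact (jointEigen hπ x m).starProjection_inner_eq_zero v w h1

theorem isFixedAt_projJ {m : ℕ} {v : H} (hv : IsFixedAt π m v) :
    IsFixedAt π m (projJ hπ x m v) := by
  have hmem : ∀ k ∈ KD, (∀ i : ℤ, |i| ≤ m → k.1 i = i) → ∀ u ∈ jointEigen hπ x m,
      (π k : H →L[ℂ] H) u ∈ jointEigen hπ x m := by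
    intro k _ hk u hu
    rw [mem_jointEigen] at hu ⊢
    intro i hi
    rw [← rep_opA hπ (hk _ (abs_le.2 ⟨by omega, by omega⟩)), hu i hi, map_smul]
  refine hv.of_comm fun k hk hki u => ?_
  refine starProjection_intertwine (inner_rep_left π k) (hmem k hk hki)
    (hmem k⁻¹ (KD.inv_mem hk) fun i hi => ?_) u
  change k.1⁻¹ i = i
  rw [Equiv.Perm.inv_eq_iff_eq, hki i hi]

theorem permHom_mem_jointEigen {m : ℕ} (e : Equiv.Perm (Fin m)) {v : H}
    (hv : v ∈ jointEigen hπ x m) :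
    (π (permHom m e) : H →L[ℂ] H) v ∈ jointEigen hπ x m := by
  rw [mem_jointEigen] at hv ⊢
  intro i hi
  obtain ⟨j, hj, h⟩ := exists_permHom_apply e hi
  rw [← rep_opA hπ h, hv j hj, map_smul]

/-! ### Matrix elements of the symmetric groups -/

theorem card_mul_sum_inner {Γ : Type*} [Group Γ] [Fintype Γ] (ρ : Γ →* GD) (χ : Γ →* ℤˣ) (u : H) :
    (Fintype.card Γ : ℂ) * ∑ σ, ((χ σ : ℤ) : ℂ) * inner ℂ ((π (ρ σ) : H →L[ℂ] H) u) u =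
      inner ℂ (∑ σ, ((χ σ : ℤ) : ℂ) • (π (ρ σ) : H →L[ℂ] H) u)
        (∑ σ, ((χ σ : ℤ) : ℂ) • (π (ρ σ) : H →L[ℂ] H) u) := by
  have h : ∀ τ : Γ, ∑ σ, ((χ σ : ℤ) : ℂ) * inner ℂ ((π (ρ σ) : H →L[ℂ] H) u) u =
      inner ℂ (∑ σ, ((χ σ : ℤ) : ℂ) • (π (ρ σ) : H →L[ℂ] H) u)
        (((χ τ : ℤ) : ℂ) • (π (ρ τ) : H →L[ℂ] H) u) := by
    intro τ
    rw [sum_inner]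
    symm
    rw [← Equiv.sum_comp (Equiv.mulLeft τ)]
    refine Finset.sum_congr rfl fun σ _ => ?_
    have hτ : ((χ τ : ℤ) : ℂ) * ((χ τ : ℤ) : ℂ) = 1 := by
      rw [← Int.cast_mul, ← Units.val_mul, Int.units_mul_self]; simp
    rw [Equiv.coe_mulLeft, map_mul, map_mul, rep_mul_apply, inner_smul_left, inner_smul_right,
      inner_rep, Units.val_mul, Int.cast_mul, map_mul, map_intCast, map_intCast]
    linear_combination ((χ σ : ℤ) : ℂ) * inner ℂ ((π (ρ σ) : H →L[ℂ] H) u) u * hτ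
  rw [inner_sum, ← Finset.sum_congr rfl fun τ _ => h τ]
  simp

theorem sum_inner_nonneg {Γ : Type*} [Group Γ] [Fintype Γ] (ρ : Γ →* GD) (χ : Γ →* ℤˣ) (u : H) :
    0 ≤ (∑ σ, ((χ σ : ℤ) : ℂ) * inner ℂ ((π (ρ σ) : H →L[ℂ] H) u) u).re := by
  have h := congrArg Complex.re (card_mul_sum_inner (π := π) ρ χ u)
  have h0 : 0 ≤ (inner ℂ (∑ σ, ((χ σ : ℤ) : ℂ) • (π (ρ σ) : H →L[ℂ] H) u)
        (∑ σ, ((χ σ : ℤ) : ℂ) • (π (ρ σ) : H →L[ℂ] H) u)).re := inner_self_nonneg (𝕜 := ℂ)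
  rw [← h, ← Complex.ofReal_natCast, Complex.re_ofReal_mul] at h0
  exact nonneg_of_mul_nonneg_right h0 (by exact_mod_cast Fintype.card_pos)

/-- The matrix element of the permutation `e` at the projected spherical vector. -/
noncomputable def matElt (ξ : H) {m : ℕ} (e : Equiv.Perm (Fin m)) : ℂ :=
  inner ℂ ((π (permHom m e) : H →L[ℂ] H) (projJ hπ x m ξ)) ξ

/-- Permutations of 1, …, m preserve the joint eigenspace, so the second vector may be projected as
well. The definition, with ξ itself there, suits the recursion; this symmetric form gives
positivity. -/
theorem matElt_eq (ξ : H) {m : ℕ} (e : Equiv.Perm (Fin m)) :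
    matElt hπ x ξ e =
      inner ℂ ((π (permHom m e) : H →L[ℂ] H) (projJ hπ x m ξ)) (projJ hπ x m ξ) := by
  have h := (jointEigen hπ x m).inner_starProjection_left_eq_right
    ((π (permHom m e) : H →L[ℂ] H) (projJ hπ x m ξ)) ξ
  rw [(jointEigen hπ x m).starProjection_eq_self_iff.2
    (permHom_mem_jointEigen hπ x e (projJ_mem hπ x m ξ))] at h
  exact h

variable {ξ : H}

theorem isFixedAt_permHom_projJ (hξ : IsSphericalVector π ξ) {m : ℕ} (e : Equiv.Perm (Fin m)) :
    IsFixedAt π m ((π (permHom m e) : H →L[ℂ] H) (projJ hπ x m ξ)) :=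
  (isFixedAt_projJ hπ x fun k hk _ => hξ.2 k hk).rep fun _ hz => permHom_apply_of_notMem e hz

theorem rep_permHom_projJ_succ {m : ℕ} (e : Equiv.Perm (Fin m)) (v : H) :
    (π (permHom m e) : H →L[ℂ] H) (projJ hπ x (m + 1) v) =
      projP hπ x m ((π (permHom m e) : H →L[ℂ] H) (projJ hπ x m v)) := by
  rw [projJ_succ, rep_projP hπ x (permHom_apply_of_notMem e (by omega))]

theorem matElt_decomposeFin_zero (hξ : IsSphericalVector π ξ) {c : ℝ} (hc : inner ℂ ξ (projP hπ x 0 ξ) = (c : ℂ)) {m : ℕ}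
    (e : Equiv.Perm (Fin m)) :
    matElt hπ x ξ (Equiv.Perm.decomposeFin.symm (0, e)) = c * matElt hπ x ξ e := by
  rw [matElt, permHom_decomposeFin_zero, rep_permHom_projJ_succ hπ x, inner_projP_left,
    inner_projP_of_isFixedAt hπ x hξ hc (isFixedAt_permHom_projJ hπ x hξ e), matElt]

theorem matElt_decomposeFin_succ (hξ : IsSphericalVector π ξ) {m : ℕ} (a : Fin m) (e : Equiv.Perm (Fin m)) :
    matElt hπ x ξ (Equiv.Perm.decomposeFin.symm (a.succ, e)) = x * matElt hπ x ξ e := by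
  have hb : m - 1 - a < m := by have := a.2; omega
  generalize hbe : m - 1 - (a : ℕ) = b at hb
  have hfix := isFixedAt_permHom_projJ hπ x hξ e
  have hmem := (mem_jointEigen hπ x).1 (permHom_mem_jointEigen hπ x e (projJ_mem hπ x m ξ)) b hb
  rw [matElt, permHom_decomposeFin_succ, hbe, rep_mul_apply, rep_permHom_projJ_succ hπ x, matElt]
  set u := (π (permHom m e) : H →L[ℂ] H) (projJ hπ x m ξ)
  -- The transposition turns `projP hπ x m` into `projP hπ x b`, which is then moved onto ξ. Both
  -- vectors are now fixed at level m, so the transposition can be replaced by `opA π hπ b`, which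
  -- acts on u as x.
  rw [rep_projP hπ x (j := b) (Equiv.swap_apply_right _ _), inner_projP_left]
  have hPξ : IsFixedAt π m (projP hπ x b ξ) := by
    refine IsFixedAt.of_comm (fun k hk _ => hξ.2 k hk) fun k _ hk u => ?_
    exact rep_projP hπ x (hk _ (abs_le.2 ⟨by omega, by omega⟩)) u
  rw [hfix.inner_tr hπ hb hPξ, hmem, inner_smul_left, Complex.conj_ofReal, ← inner_projP_left,
    (projP_eq_self hπ x).2 hmem]

end

/-! ### Sums over the symmetric groups, and integrality. -/

section

variable {H : Type*} [NormedAddCommGroup H] [InnerProductSpace ℂ H] [CompleteSpace H]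
  {π : GD →* unitary (H →L[ℂ] H)} (hπ : IsSpherical π) (x : ℝ) {ξ : H}

/-- The sign character if `0 < x`, and the trivial character otherwise. -/
noncomputable def signChar (m : ℕ) : Equiv.Perm (Fin m) →* ℤˣ :=
  if 0 < x then Equiv.Perm.sign else 1

theorem signChar_decomposeFin_zero {m : ℕ} (e : Equiv.Perm (Fin m)) :
    signChar x (m + 1) (Equiv.Perm.decomposeFin.symm (0, e)) = signChar x m e := by
  unfold signChar
  split_ifs <;> simp

/-- The character is chosen so that a transposition with the new point contributes -|x| for either
sign of x. -/
theorem signChar_decomposeFin_succ {m : ℕ} (a : Fin m) (e : Equiv.Perm (Fin m)) :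
    ((signChar x (m + 1) (Equiv.Perm.decomposeFin.symm (a.succ, e)) : ℤ) : ℂ) * x =
      -(|x| : ℝ) * ((signChar x m e : ℤ) : ℂ) := by
  unfold signChar
  split_ifs with h
  · rw [Equiv.Perm.decomposeFin.symm_sign, if_neg (Fin.succ_ne_zero a), abs_of_pos h]
    push_cast
    ring
  · rw [abs_of_nonpos (not_lt.1 h)]
    simp

/-- In passing from m to m + 1, the fixed new point gives the factor c and each of the m
transpositions gives -|x|, so the sum is multiplied by c - m|x|. -/
theorem sum_signChar_matElt (hξ : IsSphericalVector π ξ) {c : ℝ}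
    (hc : inner ℂ ξ (projP hπ x 0 ξ) = (c : ℂ)) (m : ℕ) :
    ∑ e, ((signChar x m e : ℤ) : ℂ) * matElt hπ x ξ e =
      ((∏ k ∈ Finset.range m, (c - k * |x|) : ℝ) : ℂ) := by
  induction m with
  | zero =>
    simp only [Finset.univ_unique, Finset.sum_singleton, Finset.range_zero, Finset.prod_empty]
    have h1 : (default : Equiv.Perm (Fin 0)) = 1 := rfl
    rw [h1, matElt, map_one, map_one, map_one, projJ_zero]
    simp [inner_self_eq_norm_sq_to_K, hξ.1]
  | succ m ih =>
    have hsucc : ∀ (a : Fin m) (e : Equiv.Perm (Fin m)),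
        ((signChar x (m + 1) (Equiv.Perm.decomposeFin.symm (a.succ, e)) : ℤ) : ℂ) *
          matElt hπ x ξ (Equiv.Perm.decomposeFin.symm (a.succ, e)) =
        -(|x| : ℝ) * (((signChar x m e : ℤ) : ℂ) * matElt hπ x ξ e) := fun a e => by
      rw [matElt_decomposeFin_succ hπ x hξ, ← mul_assoc, signChar_decomposeFin_succ, mul_assoc]
    have hzero : ∀ e : Equiv.Perm (Fin m),
        ((signChar x (m + 1) (Equiv.Perm.decomposeFin.symm (0, e)) : ℤ) : ℂ) *
          matElt hπ x ξ (Equiv.Perm.decomposeFin.symm (0, e)) =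
        c * (((signChar x m e : ℤ) : ℂ) * matElt hπ x ξ e) := fun e => by
      rw [matElt_decomposeFin_zero hπ x hξ hc, signChar_decomposeFin_zero]
      ring
    rw [← Equiv.sum_comp Equiv.Perm.decomposeFin.symm, Fintype.sum_prod_type, Fin.sum_univ_succ]
    simp only [hsucc, hzero, ← Finset.mul_sum, ih, Finset.prod_range_succ]
    simp
    ring

theorem prod_sub_nonneg (hξ : IsSphericalVector π ξ) {c : ℝ}
    (hc : inner ℂ ξ (projP hπ x 0 ξ) = (c : ℂ)) (m : ℕ) :
    0 ≤ ∏ k ∈ Finset.range m, (c - k * |x|) := by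
  have h := sum_inner_nonneg (π := π) (permHom m) (signChar x m) (projJ hπ x m ξ)
  simp only [← matElt_eq, sum_signChar_matElt hπ x hξ hc, Complex.ofReal_re] at h
  exact h

end

theorem exists_nat_eq_mul_of_prod_nonneg {c y : ℝ} (hy : 0 < y)
    (h : ∀ m : ℕ, 0 ≤ ∏ k ∈ Finset.range m, (c - k * y)) : ∃ n : ℕ, c = n * y := by
  by_contra! hne
  -- If no factor vanishes, all the products are strictly positive, and so is each factor as a ratio
  -- of consecutive products. This fails once n exceeds c / y.
  have hpos : ∀ m : ℕ, 0 < ∏ k ∈ Finset.range m, (c - k * y) := fun m =>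
    (h m).lt_of_ne' (Finset.prod_ne_zero_iff.2 fun k _ => sub_ne_zero.2 (hne k))
  obtain ⟨n, hn⟩ := exists_nat_gt (c / y)
  rw [div_lt_iff₀ hy] at hn
  have h1 := hpos (n + 1)
  rw [Finset.prod_range_succ] at h1
  linarith [pos_of_mul_pos_right h1 (hpos n).le]

end Olshanski

theorem theorem2 {H : Type*} [NormedAddCommGroup H] [InnerProductSpace ℂ H] [CompleteSpace H]
    (π : Olshanski.GD →* unitary (H →L[ℂ] H)) (hπ : Olshanski.IsSpherical π)
    (ξ : H) (hξ : Olshanski.IsSphericalVector π ξ) (μ : MeasureTheory.Measure ℝ)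
    (hμ : μ = Olshanski.spectralMeasure (Olshanski.opA₁ π hπ)
      (Olshanski.isSelfAdjoint_opA₁ π hπ) ξ)
    (x : ℝ) (hx : x ≠ 0) (hatom : μ {x} ≠ 0) :
    ∃ ν : ℕ, 0 < ν ∧ (μ {x}).toReal / |x| = (ν : ℝ) := by
  have hself := Olshanski.isSelfAdjoint_opA₁ π hπ
  have hspec : Olshanski.IsSpectralMeasure (Olshanski.opA₁ π hπ) ξ μ :=
    hμ ▸ Olshanski.isSpectralMeasure_spectralMeasure _ _ ξ
  have hfin : IsFiniteMeasure μ := hspec.1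
  rw [← Olshanski.opA_zero hπ] at hself hspec
  have hc : inner ℂ ξ (Olshanski.projP hπ x 0 ξ) = ((μ {x}).toReal : ℂ) :=
    Olshanski.inner_starProjection_eigen hself hspec x
  have hx' : 0 < |x| := abs_pos.2 hx
  obtain ⟨n, hn⟩ := Olshanski.exists_nat_eq_mul_of_prod_nonneg hx'
    (Olshanski.prod_sub_nonneg hπ x hξ hc)
  refine ⟨n, Nat.pos_of_ne_zero ?_, by rw [hn, mul_div_cancel_right₀ _ hx'.ne']⟩
  rintro rfl
  exact (ENNReal.toReal_pos hatom (measure_ne_top μ _)).ne' (by simpa using hn)
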